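/- For an integer $x$ let $P_8(x)=3x^2-2x$ (a generalized octagonal number; $x$ may be negative). The sum $P_8(x)+P_8(y)+3P_8(z)+3P_8(t)$ is universal over $\mathbb Z$: for every integer $n\ge 0$ there are $x,y,z,t\in\mathbb Z$ with $$P_8(x)+P_8(y)+3P_8(z)+3P_8(t)=n.$$ Equivalently, for every integer $n\ge 0$ the equation $$x^2+y^2+3z^2+3t^2=3n+8$$ has a solution $(x,y,z,t)\in\mathbb Z^4$ with $xyzt\not\equiv 0\pmod 3$. -/

import Mathlib

/-- The generalized octagonal number `P₈(x) = 3x² - 2x`, for an arbitrary integer `x`. -/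
def octagonal (x : ℤ) : ℤ := 3 * x ^ 2 - 2 * x

/-- The quaternary sum `Φ_{a,b,c,d}(x,y,z,t) = a P₈(x) + b P₈(y) + c P₈(z) + d P₈(t)`. -/
def octagonalSum (a b c d x y z t : ℤ) : ℤ :=
  a * octagonal x + b * octagonal y + c * octagonal z + d * octagonal t

/-- `Φ_{a,b,c,d}` is universal over `ℤ`: it represents every non-negative integer,
with integer (possibly negative) arguments. -/
def IsUniversalOctagonalSum (a b c d : ℤ) : Prop :=
  ∀ n : ℕ, ∃ x y z t : ℤ, octagonalSum a b c d x y z t = (n : ℤ)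

/-!
Since `3 P₈(u) + 1 = (3u - 1)²` and every integer prime to `3` is `±(3u - 1)`, both claims say that
each `N = 3n + 8` is `x² + y² + 3z² + 3t²` with all four variables prime to `3`. As `N ≡ 2 (mod 3)`,
this is automatic for `x` and `y`, and only `z` and `t` matter. The bound `N ≥ 8` is needed: there
is no such representation of `2` and `5`.

The arithmetic input is that `x² + y² + 3z²` represents every positive `M` prime to `3`
(`exists_ternary`). Dirichlet's theorem gives a prime `p ≡ 16M - 3 (mod 24M)`. By quadratic
reciprocity `M X² = 3 Z² + p Y²` satisfies the congruence conditions of Legendre's theorem, so it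
has a nontrivial solution; as `p ≡ 1 (mod 4)` is a sum of two squares, `M` is represented over `ℚ`.
The form `x² + y² + yz + z²` admits the Davenport–Cassels descent, which makes the representation
integral, and `y² + yz + z²` takes the same values as `y² + 3z²`.

To represent `N`, a value of `t` prime to `3` is prescribed, the ternary theorem is applied to the
rest, and if a factor `3` is left in `z` it is removed by the automorphs
`(y, z) ↦ ((y ∓ 3z) / 2, (y ± z) / 2)` of `y² + 3z²`. These are integral only for `y ≡ z (mod 2)`,
which is why the prescribed `t` depends on `N` modulo `4` and `8`. For `N ≡ 2 (mod 4)` a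
similar argument yields a representation of `N / 2` in which exactly one of `z` and `t` is divisible
by `3`, and `z + t`, `z - t` serve for `N`. If `4 ∣ N`, a representation of `N / 4` is doubled.
-/

/-! ### The auxiliary equation `M X² = 3 Z² + p Y²` -/

/-- The ellipse method behind Legendre's theorem: the congruences make `M X² - 3 Z² - p Y²`
divisible by `3 M p` on a lattice, and the box is so small that only `0` and `-3 M p` remain. -/
lemma exists_small_value (M p : ℕ) (hM : 0 < M) (h3 : ¬ 3 ∣ M) (hp : p.Prime) (hp8 : p % 8 = 5)
    (hpM : (M : ℤ) ∣ p + 3) (hp3 : (3 : ℤ) ∣ (p : ℤ) - M) (s : ℤ)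
    (hs : (p : ℤ) ∣ s ^ 2 - 3 * M) :
    ∃ X Y Z : ℤ, (X ≠ 0 ∨ Y ≠ 0 ∨ Z ≠ 0) ∧
      ((M : ℤ) * X ^ 2 = 3 * Z ^ 2 + p * Y ^ 2 ∨
        (M : ℤ) * (X ^ 2 + 3 * p) = 3 * Z ^ 2 + p * Y ^ 2) := by
  have : NeZero M := ⟨hM.ne'⟩
  have : NeZero p := ⟨hp.ne_zero⟩
  set A := Nat.sqrt (3 * p) with hA
  set B := Nat.sqrt (3 * M) with hB
  set C := Nat.sqrt (M * p) with hC
  let box : Finset (ℕ × ℕ × ℕ) :=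
    Finset.range (A + 1) ×ˢ (Finset.range (B + 1) ×ˢ Finset.range (C + 1))
  -- The three congruences are linear factors of `M X² - 3 Z² - p Y²` modulo `M`, `3` and `p`.
  let φ : ℕ × ℕ × ℕ → ZMod M × ZMod 3 × ZMod p := fun v =>
    ((v.2.2 : ZMod M) - v.2.1, (v.1 : ZMod 3) - v.2.1, (M : ZMod p) * v.1 - (s : ZMod p) * v.2.2)
  have hcard : (Finset.univ : Finset (ZMod M × ZMod 3 × ZMod p)).card < box.card := by
    simp only [Finset.card_univ, Fintype.card_prod, ZMod.card, box, Finset.card_product,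
      Finset.card_range]
    have h1 : 3 * p < (A + 1) ^ 2 := by rw [sq]; exact Nat.lt_succ_sqrt _
    have h2 : 3 * M < (B + 1) ^ 2 := by rw [sq]; exact Nat.lt_succ_sqrt _
    have h4 : M * p < (C + 1) ^ 2 := by rw [sq]; exact Nat.lt_succ_sqrt _
    refine lt_of_pow_lt_pow_left₀ 2 (Nat.zero_le _) ?_
    calc (M * (3 * p)) ^ 2 = (3 * p) * ((3 * M) * (M * p)) := by ring
      _ < (A + 1) ^ 2 * ((B + 1) ^ 2 * (C + 1) ^ 2) :=
          Nat.mul_lt_mul'' h1 (Nat.mul_lt_mul'' h2 h4)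
      _ = _ := by ring
  obtain ⟨⟨x, y, z⟩, hv, ⟨x', y', z'⟩, hv', hne, heq⟩ :=
    Finset.exists_ne_map_eq_of_card_lt_of_maps_to hcard (f := φ) (fun _ _ => Finset.mem_univ _)
  simp only [box, Finset.mem_product, Finset.mem_range] at hv hv'
  simp only [φ, Prod.mk.injEq] at heq
  obtain ⟨e1, e2, e3⟩ := heq
  have hA2 : ((A : ℤ)) ^ 2 ≤ 3 * p := by
    have := Nat.sqrt_le' (3 * p); exact_mod_cast this
  have hB2 : ((B : ℤ)) ^ 2 ≤ 3 * M := by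
    have := Nat.sqrt_le' (3 * M); exact_mod_cast this
  have hC2 : ((C : ℤ)) ^ 2 ≤ M * p := by
    have := Nat.sqrt_le' (M * p); exact_mod_cast this
  obtain ⟨X, hX⟩ : ∃ X : ℤ, X = x - x' := ⟨_, rfl⟩
  obtain ⟨Y, hY⟩ : ∃ Y : ℤ, Y = y - y' := ⟨_, rfl⟩
  obtain ⟨Z, hZ⟩ : ∃ Z : ℤ, Z = z - z' := ⟨_, rfl⟩
  have hXA : X ^ 2 ≤ 3 * p := by
    refine le_trans (sq_le_sq' ?_ ?_) hA2 <;> omega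
  have hYB : Y ^ 2 ≤ 3 * M := by
    refine le_trans (sq_le_sq' ?_ ?_) hB2 <;> omega
  have hZC : Z ^ 2 ≤ M * p := by
    refine le_trans (sq_le_sq' ?_ ?_) hC2 <;> omega
  have d1 : (M : ℤ) ∣ Z - Y := by
    rw [← ZMod.intCast_zmod_eq_zero_iff_dvd, hZ, hY]; push_cast
    linear_combination e1
  have d2 : (3 : ℤ) ∣ X - Y := by
    have := (ZMod.intCast_zmod_eq_zero_iff_dvd (X - Y) 3).1 (by
      rw [hX, hY]; push_cast; linear_combination e2)
    exact_mod_cast this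
  have d3 : (p : ℤ) ∣ M * X - s * Z := by
    rw [← ZMod.intCast_zmod_eq_zero_iff_dvd, hX, hZ]; push_cast
    linear_combination e3
  have hnz : X ≠ 0 ∨ Y ≠ 0 ∨ Z ≠ 0 := by
    by_contra! h
    apply hne
    simp only [Prod.mk.injEq]
    omega
  -- `3 p ≡ 7 (mod 8)` is not a square.
  have hX3 : X ^ 2 ≠ 3 * p := by
    intro h
    have : X % 8 = 0 ∨ X % 8 = 1 ∨ X % 8 = 2 ∨ X % 8 = 3 ∨ X % 8 = 4 ∨ X % 8 = 5 ∨ X % 8 = 6 ∨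
      X % 8 = 7 := by omega
    have h8 : X ^ 2 % 8 = 7 := by omega
    rcases this with h | h | h | h | h | h | h | h <;> simp [pow_two, Int.mul_emod, h] at h8
  have hY3 : Y ^ 2 ≠ 3 * M := by
    intro h
    obtain ⟨k, hk⟩ : (3 : ℤ) ∣ Y := Int.prime_three.dvd_of_dvd_pow ⟨_, h⟩
    rw [hk] at h
    have : (M : ℤ) = 3 * k ^ 2 := by linarith
    exact h3 (Int.natCast_dvd_natCast.1 ⟨k ^ 2, this⟩)
  obtain ⟨f, hf⟩ : ∃ f : ℤ, f = M * X ^ 2 - 3 * Z ^ 2 - p * Y ^ 2 := ⟨_, rfl⟩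
  have f1 : (M : ℤ) ∣ f := by
    obtain ⟨u, hu⟩ := hpM
    obtain ⟨v, hv⟩ := d1
    refine ⟨X ^ 2 - 3 * v * (Z + Y) - u * Y ^ 2, ?_⟩
    linear_combination hf - Y ^ 2 * hu - 3 * (Z + Y) * hv
  have f2 : (3 : ℤ) ∣ f := by
    obtain ⟨u, hu⟩ := hp3
    obtain ⟨v, hv⟩ := d2
    refine ⟨M * v * (X + Y) - Z ^ 2 - u * Y ^ 2, ?_⟩
    linear_combination hf - Y ^ 2 * hu + M * (X + Y) * hv
  have hpM' : ¬ p ∣ M := by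
    intro h
    have h1 : (p : ℤ) ∣ p + 3 := (Int.natCast_dvd_natCast.2 h).trans hpM
    have h2 : (p : ℤ) ∣ 3 := by simpa using h1
    have h5 : p ∣ 3 := by exact_mod_cast h2
    have := Nat.le_of_dvd (by norm_num) h5
    interval_cases p <;> omega
  have f3 : (p : ℤ) ∣ f := by
    have : (p : ℤ) ∣ M * f := by
      obtain ⟨u, hu⟩ := hs
      obtain ⟨v, hv⟩ := d3
      refine ⟨v * (M * X + s * Z) + u * Z ^ 2 - M * Y ^ 2, ?_⟩
      linear_combination M * hf + (M * X + s * Z) * hv + Z ^ 2 * hu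
    rcases (Nat.prime_iff_prime_int.1 hp).dvd_or_dvd this with h | h
    · exact absurd (by exact_mod_cast h) hpM'
    · exact h
  have c1 : IsCoprime (M : ℤ) 3 := by
    have : Nat.Coprime M 3 := ((Nat.Prime.coprime_iff_not_dvd Nat.prime_three).2 h3).symm
    exact_mod_cast Nat.isCoprime_iff_coprime.2 this
  have c2 : IsCoprime ((M : ℤ) * 3) p := by
    have a1 : Nat.Coprime M p := ((Nat.Prime.coprime_iff_not_dvd hp).2 hpM').symm
    have a2 : Nat.Coprime 3 p := (Nat.coprime_primes Nat.prime_three hp).2 (by omega)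
    exact_mod_cast Nat.isCoprime_iff_coprime.2 (Nat.Coprime.mul_left a1 a2)
  obtain ⟨k, hk⟩ := c2.mul_dvd (c1.mul_dvd f1 f2) f3
  have hMp : (0 : ℤ) < M * 3 * p := by
    have := hp.pos
    positivity
  have hM' : (0 : ℤ) < M := by exact_mod_cast hM
  have hp' : (0 : ℤ) < p := by exact_mod_cast hp.pos
  have hpY : 0 ≤ (p : ℤ) * Y ^ 2 := by positivity
  have hMX : 0 ≤ (M : ℤ) * X ^ 2 := by positivity
  have hZ0 := sq_nonneg Z
  have hX' : (M : ℤ) * X ^ 2 < M * (3 * p) :=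
    mul_lt_mul_of_pos_left (lt_of_le_of_ne hXA hX3) hM'
  have hY' : (p : ℤ) * Y ^ 2 < p * (3 * M) :=
    mul_lt_mul_of_pos_left (lt_of_le_of_ne hYB hY3) hp'
  have hup : M * 3 * p * k < M * 3 * p * 1 := by linarith
  have hlo : M * 3 * p * (-2) < M * 3 * p * k := by linarith
  have hk1 : k < 1 := lt_of_mul_lt_mul_left hup hMp.le
  have hk2 : -2 < k := lt_of_mul_lt_mul_left hlo hMp.le
  refine ⟨X, Y, Z, hnz, ?_⟩
  obtain rfl | rfl : k = 0 ∨ k = -1 := by omega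
  · left; linarith
  · right; linarith

lemma exists_sq_eq_of_congruences (M p : ℕ) (hM : 0 < M) (h3 : ¬ 3 ∣ M) (hp : p.Prime)
    (hp8 : p % 8 = 5) (hpM : (M : ℤ) ∣ p + 3) (hp3 : (3 : ℤ) ∣ (p : ℤ) - M) (s : ℤ)
    (hs : (p : ℤ) ∣ s ^ 2 - 3 * M) :
    ∃ X Y Z : ℤ, X ≠ 0 ∧ (M : ℤ) * X ^ 2 = 3 * Z ^ 2 + p * Y ^ 2 := by
  have hp' : (0 : ℤ) < p := by exact_mod_cast hp.pos
  obtain ⟨X, Y, Z, hnz, h | h⟩ := exists_small_value M p hM h3 hp hp8 hpM hp3 s hs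
  · refine ⟨X, Y, Z, ?_, h⟩
    rintro rfl
    have hZ : Z ^ 2 = 0 := by nlinarith [sq_nonneg Z, mul_nonneg hp'.le (sq_nonneg Y)]
    have hY : (p : ℤ) * Y ^ 2 = 0 := by nlinarith
    have hZ0 : Z = 0 := by simpa using hZ
    have hY0 : Y = 0 := by simpa [hp.ne_zero] using hY
    simp [hY0, hZ0] at hnz
  · -- `X² + 3p` is a norm from `ℚ(√(-3p))`, and `3 Z² + p Y²` is a third of a norm; so multiplying
    -- the equation by `X² + 3p` keeps the shape of the right-hand side.
    refine ⟨X ^ 2 + 3 * p, X * Y - 3 * Z, Z * X + p * Y, by positivity, ?_⟩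
    linear_combination (X ^ 2 + 3 * p) * h

/-! ### Rational representations by `x² + y² + 3z²` -/

lemma jacobiSym_neg_three {m : ℕ} (hm : Odd m) : jacobiSym (-3) m = jacobiSym m 3 := by
  have h := jacobiSym.neg 3 hm
  rw [h]
  rcases Nat.odd_mod_four_iff.1 (Nat.odd_iff.1 hm) with h4 | h4
  · rw [ZMod.χ₄_nat_one_mod_four h4, one_mul]
    exact_mod_cast (jacobiSym.quadratic_reciprocity_one_mod_four h4 (by decide : Odd 3)).symm
  · rw [ZMod.χ₄_nat_three_mod_four h4]
    have := jacobiSym.quadratic_reciprocity_three_mod_four h4 (by norm_num : 3 % 4 = 3)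
    push_cast at this
    rw [this]; ring

/-- Quadratic reciprocity: the congruences on `p` make `3 M` a square modulo `p`. -/
lemma jacobiSym_three_mul {M p : ℕ} (hM : 0 < M) (h3 : ¬ 3 ∣ M) (hp8 : p % 8 = 5)
    (hpM : (M : ℤ) ∣ p + 3) (hp3 : (3 : ℤ) ∣ (p : ℤ) - M) : jacobiSym (3 * M) p = 1 := by
  have hpo : Odd p := Nat.odd_iff.2 (by omega)
  obtain ⟨e, m, hm, rfl⟩ := Nat.exists_eq_two_pow_mul_odd hM.ne'
  have h2p : jacobiSym 2 p = -1 := by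
    rw [jacobiSym.at_two hpo, ZMod.χ₈_nat_eq_if_mod_eight]
    have : p % 2 = 1 := by omega
    simp [hp8, this]
  have h23 : jacobiSym 2 3 = -1 := by
    rw [jacobiSym.at_two (by decide)]; decide
  have h3p : jacobiSym 3 p = jacobiSym (2 ^ e * m : ℕ) 3 := by
    have h1 : jacobiSym (3 : ℕ) p = jacobiSym p 3 :=
      (jacobiSym.quadratic_reciprocity_one_mod_four (by omega : p % 4 = 1) (by decide)).symm
    rw [show (3 : ℤ) = ((3 : ℕ) : ℤ) by norm_num, h1]
    exact jacobiSym.mod_left' (Int.modEq_iff_dvd.2 hp3).symm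
  have hmp : jacobiSym m p = jacobiSym m 3 := by
    rw [← jacobiSym.quadratic_reciprocity_one_mod_four (by omega : p % 4 = 1) hm,
      ← jacobiSym_neg_three hm]
    refine jacobiSym.mod_left' (Int.ModEq.symm (Int.modEq_iff_dvd.2 ?_))
    have : (m : ℤ) ∣ ((2 ^ e * m : ℕ) : ℤ) := by push_cast; exact dvd_mul_left _ _
    simpa using this.trans hpM
  have hm3 : jacobiSym m 3 ^ 2 = 1 := by
    apply jacobiSym.sq_one
    have : Nat.Coprime 3 m := (Nat.Prime.coprime_iff_not_dvd Nat.prime_three).2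
      fun h => h3 (h.mul_left _)
    rw [Int.gcd_comm]; exact_mod_cast this
  rw [jacobiSym.mul_left, h3p]
  push_cast
  rw [jacobiSym.mul_left, jacobiSym.mul_left, jacobiSym.pow_left, jacobiSym.pow_left, h2p, h23, hmp]
  have : ((-1 : ℤ) ^ e) ^ 2 = 1 := by rw [← pow_mul, mul_comm, pow_mul]; simp
  linear_combination jacobiSym (m : ℤ) 3 ^ 2 * this + hm3

/-- `M` is represented by `x² + y² + 3z²` over `ℚ`; Dirichlet's theorem supplies an auxiliary prime
`p = u² + v²` such that `M` is represented by `p y² + 3 z²`. -/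
lemma exists_rational_representation {M : ℕ} (hM : 0 < M) (h3 : ¬ 3 ∣ M) :
    ∃ T x y z : ℤ, T ≠ 0 ∧ (M : ℤ) * T ^ 2 = x ^ 2 + y ^ 2 + 3 * z ^ 2 := by
  have : NeZero (24 * M) := ⟨by omega⟩
  -- `16 M - 3` is congruent to `5` modulo `8`, to `M` modulo `3` and to `-3` modulo `M`.
  have hu : IsUnit ((16 * M - 3 : ℕ) : ZMod (24 * M)) := by
    rw [ZMod.isUnit_iff_coprime]
    have h8 : Nat.Coprime (16 * M - 3) 8 := by
      have : Nat.Coprime (16 * M - 3) (2 ^ 3) :=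
        Nat.Coprime.pow_right _ (Nat.coprime_two_right.2 (Nat.odd_iff.2 (by omega)))
      exact this
    have h3' : Nat.Coprime (16 * M - 3) 3 :=
      ((Nat.Prime.coprime_iff_not_dvd Nat.prime_three).2 (by omega)).symm
    have hMM : Nat.Coprime (16 * M - 3) M := by
      have hc : Nat.Coprime 3 M := (Nat.Prime.coprime_iff_not_dvd Nat.prime_three).2 h3
      have h1 := Nat.gcd_dvd_left (16 * M - 3) M
      have h2 := Nat.gcd_dvd_right (16 * M - 3) M
      have h5 : Nat.gcd (16 * M - 3) M ∣ 3 := by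
        have := Nat.dvd_sub (h2.mul_left 16) h1
        rwa [show 16 * M - (16 * M - 3) = 3 by omega] at this
      exact Nat.eq_one_of_dvd_coprimes hc h5 h2
    exact (h8.mul_right h3').mul_right hMM
  obtain ⟨p, -, hp, hpe⟩ := Nat.forall_exists_prime_gt_and_eq_mod hu 0
  have hd : (24 * M : ℤ) ∣ (p : ℤ) - (16 * M - 3) := by
    have h := (ZMod.natCast_eq_natCast_iff _ _ _).1 hpe
    have h := (Nat.modEq_iff_dvd.1 h.symm)
    push_cast [show 3 ≤ 16 * M by omega] at h
    exact h
  obtain ⟨k, hk⟩ := hd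
  have hp8 : p % 8 = 5 := by
    have : (p : ℤ) = 8 * (M * (3 * k + 2)) - 3 := by linear_combination hk
    omega
  have hpM : (M : ℤ) ∣ p + 3 := ⟨24 * k + 16, by linear_combination hk⟩
  have hp3 : (3 : ℤ) ∣ (p : ℤ) - M := ⟨8 * M * k + 5 * M - 1, by linear_combination hk⟩
  have : Fact p.Prime := ⟨hp⟩
  have hJ := jacobiSym_three_mul hM h3 hp8 hpM hp3
  rw [← jacobiSym.legendreSym.to_jacobiSym] at hJ
  have h0 : ((3 * M : ℤ) : ZMod p) ≠ 0 := by
    intro h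
    rw [(legendreSym.eq_zero_iff p _).2 h] at hJ
    exact zero_ne_one hJ
  obtain ⟨r, hr⟩ := (legendreSym.eq_one_iff p h0).1 hJ
  obtain ⟨s, rfl⟩ := ZMod.intCast_surjective r
  have hs : (p : ℤ) ∣ s ^ 2 - 3 * M := by
    rw [← ZMod.intCast_zmod_eq_zero_iff_dvd]
    push_cast at hr ⊢
    linear_combination -hr
  obtain ⟨X, Y, Z, hX, h⟩ := exists_sq_eq_of_congruences M p hM h3 hp hp8 hpM hp3 s hs
  obtain ⟨u, v, huv⟩ := Nat.Prime.sq_add_sq (p := p) (by omega)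
  have huv' : (u : ℤ) ^ 2 + (v : ℤ) ^ 2 = p := by exact_mod_cast huv
  exact ⟨X, u * Y, v * Y, Z, hX, by rw [h, ← huv']; ring⟩

/-! ### Integral representations by `x² + y² + 3z²` -/

/-- The Davenport–Cassels descent for `x² + y² + yz + z²`: the line through a rational point with
denominator `T` and a nearby lattice point meets the quadric again in a point of smaller
denominator. -/
lemma exists_integral_of_rational (M : ℤ) (T : ℕ) (hT : 0 < T) (A B C : ℤ)
    (h : M * T ^ 2 = A ^ 2 + (B ^ 2 + B * C + C ^ 2)) :
    ∃ x y z : ℤ, M = x ^ 2 + (y ^ 2 + y * z + z ^ 2) := by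
  induction T using Nat.strong_induction_on generalizing A B C with
  | _ T ih =>
  have hT' : (0 : ℤ) < T := by exact_mod_cast hT
  have round : ∀ (w : ℤ) (d : ℤ), 0 < d → ∃ a : ℤ, |2 * (d * a - w)| ≤ d := by
    intro w d hd
    refine ⟨(2 * w + d) / (2 * d), ?_⟩
    have h1 := Int.emod_add_mul_ediv (2 * w + d) (2 * d)
    have h2 := Int.emod_nonneg (2 * w + d) (by omega : 2 * d ≠ 0)
    have h3 := Int.emod_lt_of_pos (2 * w + d) (by omega : 0 < 2 * d)
    rw [abs_le]; constructor <;> linarith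
  obtain ⟨a, ha⟩ := round A T hT'
  obtain ⟨c, hc⟩ := round C T hT'
  -- `b` is chosen after `c`, to make `v + w / 2` small in `v² + vw + w² = (v + w / 2)² + 3w² / 4`.
  obtain ⟨b, hb⟩ := round (2 * B - (T * c - C)) (2 * T) (by omega)
  obtain ⟨u, hu⟩ : ∃ u : ℤ, u = T * a - A := ⟨_, rfl⟩
  obtain ⟨v, hv⟩ : ∃ v : ℤ, v = T * b - B := ⟨_, rfl⟩
  obtain ⟨w, hw⟩ : ∃ w : ℤ, w = T * c - C := ⟨_, rfl⟩
  have hu2 : (2 * u) ^ 2 ≤ (T : ℤ) ^ 2 := by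
    rw [hu]; exact sq_le_sq' (abs_le.1 ha).1 (abs_le.1 ha).2
  have hw2 : (2 * w) ^ 2 ≤ (T : ℤ) ^ 2 := by
    rw [hw]; exact sq_le_sq' (abs_le.1 hc).1 (abs_le.1 hc).2
  have hv2 : (2 * v + w) ^ 2 ≤ (T : ℤ) ^ 2 := by
    have := abs_le.1 hb
    apply sq_le_sq' <;> rw [hv, hw] <;> linarith [this.1, this.2]
  obtain ⟨α, hα⟩ : ∃ α : ℤ, α = a ^ 2 + (b ^ 2 + b * c + c ^ 2) - M := ⟨_, rfl⟩
  obtain ⟨β, hβ⟩ : ∃ β : ℤ,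
    β = 2 * M * T - (2 * A * a + 2 * B * b + B * c + C * b + 2 * C * c) := ⟨_, rfl⟩
  obtain ⟨E, hE⟩ : ∃ E : ℤ, E = α * T + β := ⟨_, rfl⟩
  have key : u ^ 2 + (v ^ 2 + v * w + w ^ 2) = T * E := by
    rw [hE, hu, hv, hw, hα, hβ]; linear_combination -h
  have key' : 16 * (T * E) = 4 * (2 * u) ^ 2 + 4 * (2 * v + w) ^ 2 + 3 * (2 * w) ^ 2 := by
    rw [← key]; ring
  have hnn : 0 ≤ E := by
    have : 0 ≤ T * E := by
      linarith [sq_nonneg (2 * u), sq_nonneg (2 * v + w), sq_nonneg (2 * w)]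
    exact nonneg_of_mul_nonneg_right this hT'
  have hlt : E < T := by
    have hTT : (0 : ℤ) < T * T := mul_pos hT' hT'
    have : T * E < T * T := by linarith
    exact lt_of_mul_lt_mul_left this hT'.le
  obtain ⟨T', hT2⟩ := Int.eq_ofNat_of_zero_le hnn
  rcases Nat.eq_zero_or_pos T' with h0 | hpos
  · have hE0 : (T : ℤ) * E = 0 := by rw [hT2, h0]; simp
    have hu0 : 2 * u = 0 := pow_eq_zero_iff two_ne_zero |>.1 (by
      linarith [sq_nonneg (2 * u), sq_nonneg (2 * v + w), sq_nonneg (2 * w)])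
    have hv0 : 2 * v + w = 0 := pow_eq_zero_iff two_ne_zero |>.1 (by
      linarith [sq_nonneg (2 * u), sq_nonneg (2 * v + w), sq_nonneg (2 * w)])
    have hw0 : 2 * w = 0 := pow_eq_zero_iff two_ne_zero |>.1 (by
      linarith [sq_nonneg (2 * u), sq_nonneg (2 * v + w), sq_nonneg (2 * w)])
    have hA : A = T * a := by linarith
    have hB : B = T * b := by linarith
    have hC : C = T * c := by linarith
    have hne : (T : ℤ) ^ 2 ≠ 0 := by positivity
    refine ⟨a, b, c, mul_right_cancel₀ hne ?_⟩
    rw [h, hA, hB, hC]; ring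
  · refine ih T' (by omega) hpos (α * A + β * a) (α * B + β * b) (α * C + β * c) ?_
    rw [← hT2, hE]
    linear_combination α ^ 2 * h - α * β * hβ + β ^ 2 * hα

lemma exists_eq_sq_add_three_mul_sq (y z : ℤ) :
    ∃ u v : ℤ, y ^ 2 + y * z + z ^ 2 = u ^ 2 + 3 * v ^ 2 := by
  rcases Int.even_or_odd' z with ⟨k, rfl | rfl⟩
  · exact ⟨y + k, k, by ring⟩
  rcases Int.even_or_odd' y with ⟨l, rfl | rfl⟩
  · exact ⟨2 * k + 1 + l, l, by ring⟩
  · exact ⟨k - l, k + l + 1, by ring⟩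

/-- The form `x² + y² + 3z²` represents every positive integer prime to `3`. -/
lemma exists_ternary {M : ℤ} (hM : 0 < M) (h3 : ¬ 3 ∣ M) :
    ∃ x y z : ℤ, M = x ^ 2 + y ^ 2 + 3 * z ^ 2 := by
  lift M to ℕ using hM.le
  obtain ⟨T, x, y, z, hT, h⟩ := exists_rational_representation (M := M) (by exact_mod_cast hM)
    (fun hd => h3 (by exact_mod_cast hd))
  obtain ⟨a, b, c, habc⟩ := exists_integral_of_rational M T.natAbs (Int.natAbs_pos.2 hT)
    x (y - z) (2 * z) (by rw [Int.natCast_natAbs, sq_abs]; linear_combination h)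
  obtain ⟨u, v, huv⟩ := exists_eq_sq_add_three_mul_sq b c
  exact ⟨a, u, v, by rw [habc, huv]; ring⟩

/-! ### Quaternary representations with variables prime to `3` -/

/-- `N` is a value of `x² + y² + 3z² + 3t²` with `z` and `t` prime to `3`. -/
def HasPrimeToThreeRep (N : ℤ) : Prop :=
  ∃ x y z t : ℤ, x ^ 2 + y ^ 2 + 3 * z ^ 2 + 3 * t ^ 2 = N ∧ ¬ 3 ∣ z ∧ ¬ 3 ∣ t

lemma sq_emod_three (x : ℤ) : (3 ∣ x ∧ x ^ 2 % 3 = 0) ∨ (¬ 3 ∣ x ∧ x ^ 2 % 3 = 1) := by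
  have : x % 3 = 0 ∨ x % 3 = 1 ∨ x % 3 = 2 := by omega
  rcases this with h | h | h <;> simp [pow_two, Int.mul_emod, h, Int.dvd_iff_emod_eq_zero]

lemma sq_emod_eight (x : ℤ) :
    (x % 2 = 1 ∧ x ^ 2 % 8 = 1) ∨ (x % 2 = 0 ∧ (x ^ 2 % 8 = 0 ∨ x ^ 2 % 8 = 4)) := by
  have : x % 8 = 0 ∨ x % 8 = 1 ∨ x % 8 = 2 ∨ x % 8 = 3 ∨ x % 8 = 4 ∨ x % 8 = 5 ∨ x % 8 = 6 ∨
      x % 8 = 7 := by omega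
  have h2 : x % 2 = x % 8 % 2 := by omega
  rcases this with h | h | h | h | h | h | h | h <;> simp [pow_two, Int.mul_emod, h, h2]

/-- An automorph of `y² + 3t²`, multiplication by a sixth root of unity in `ℚ(√-3)`, removes a
factor `3` from `t`. -/
lemma exists_twist_not_dvd {y t : ℤ} (hpar : y % 2 = t % 2) (hy : ¬ 3 ∣ y) :
    ∃ y' t' : ℤ, y' ^ 2 + 3 * t' ^ 2 = y ^ 2 + 3 * t ^ 2 ∧ ¬ 3 ∣ t' := by
  by_cases ht : 3 ∣ t
  · obtain ⟨k, hk⟩ : ∃ k, y = t + 2 * k := ⟨(y - t) / 2, by omega⟩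
    exact ⟨k - t, k + t, by rw [hk]; ring, by omega⟩
  · exact ⟨y, t, rfl, ht⟩

/-- The same automorphs, with a suitable sign, introduce a factor `3` into `t`. -/
lemma exists_twist_dvd {y t : ℤ} (hpar : y % 2 = t % 2) (hy : ¬ 3 ∣ y) :
    ∃ y' t' : ℤ, y' ^ 2 + 3 * t' ^ 2 = y ^ 2 + 3 * t ^ 2 ∧ 3 ∣ t' := by
  by_cases ht : 3 ∣ t
  · exact ⟨y, t, rfl, ht⟩
  obtain ⟨k, hk⟩ : ∃ k, y = t + 2 * k := ⟨(y - t) / 2, by omega⟩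
  by_cases h : 3 ∣ k
  · exact ⟨k + 2 * t, k, by rw [hk]; ring, h⟩
  · refine ⟨k - t, k + t, by rw [hk]; ring, ?_⟩
    have h1 : t % 3 = 1 ∨ t % 3 = 2 := by omega
    have h2 : k % 3 = 1 ∨ k % 3 = 2 := by omega
    rcases h1 with h1 | h1 <;> rcases h2 with h2 | h2 <;> omega

/-- If `x` and `y` have different parities, one of them has the parity of `t`, so an automorph of
`y² + 3t²` or `x² + 3t²` is integral. -/
lemma hasPrimeToThreeRep_of_parity {N x y z t : ℤ} (hN : N % 3 = 2)
    (h : x ^ 2 + y ^ 2 + 3 * z ^ 2 + 3 * t ^ 2 = N) (hz : ¬ 3 ∣ z) (hxy : x % 2 ≠ y % 2) :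
    HasPrimeToThreeRep N := by
  have hx := sq_emod_three x
  have hy := sq_emod_three y
  by_cases hpar : y % 2 = t % 2
  · obtain ⟨y', t', e, ht⟩ := exists_twist_not_dvd hpar (by omega : ¬ 3 ∣ y)
    exact ⟨x, y', z, t', by linarith, hz, ht⟩
  · obtain ⟨x', t', e, ht⟩ := exists_twist_not_dvd (by omega : x % 2 = t % 2) (by omega : ¬ 3 ∣ x)
    exact ⟨x', y, z, t', by linarith, hz, ht⟩

/-- In `2 (a² + b² + 3c² + 3d²) = (a + b)² + (a - b)² + 3 (c + d)² + 3 (c - d)²` exactly one of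
`c`, `d` has to be divisible by `3`. -/
lemma hasPrimeToThreeRep_two_mul {N a b c d : ℤ} (hN : N % 3 = 1)
    (h : a ^ 2 + b ^ 2 + 3 * c ^ 2 + 3 * d ^ 2 = N) (hd : ¬ 3 ∣ d) (hcd : c % 2 ≠ d % 2) :
    HasPrimeToThreeRep (2 * N) := by
  have base : ∀ {a b c d : ℤ}, a ^ 2 + b ^ 2 + 3 * c ^ 2 + 3 * d ^ 2 = N → ¬ 3 ∣ d → 3 ∣ c →
      HasPrimeToThreeRep (2 * N) := fun {a b c d} h hd hc =>
    ⟨a + b, a - b, c + d, c - d, by rw [← h]; ring, by omega, by omega⟩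
  have main : ∀ {a b : ℤ}, a ^ 2 + b ^ 2 + 3 * c ^ 2 + 3 * d ^ 2 = N → ¬ 3 ∣ a →
      HasPrimeToThreeRep (2 * N) := by
    intro a b h ha
    by_cases hc : 3 ∣ c
    · exact base h hd hc
    by_cases hpar : a % 2 = c % 2
    · obtain ⟨a', c', e, hc'⟩ := exists_twist_dvd hpar ha
      exact base (a := a') (b := b) (c := c') (d := d) (by linarith) hd hc'
    · obtain ⟨a', d', e, hd'⟩ := exists_twist_dvd (by omega : a % 2 = d % 2) ha
      exact base (a := a') (b := b) (c := d') (d := c) (by linarith) hc hd'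
  have h1 := sq_emod_three a
  have h2 := sq_emod_three b
  by_cases ha : 3 ∣ a
  · exact main (a := b) (b := a) (by linarith) (by omega)
  · exact main h ha

lemma hasPrimeToThreeRep_one_mod_four {N : ℤ} (h8 : 8 ≤ N) (hN : N % 3 = 2) (h4 : N % 4 = 1) :
    HasPrimeToThreeRep N := by
  have main : ∀ s : ℤ, ¬ 3 ∣ s → 0 < N - 12 * s ^ 2 → (N - 12 * s ^ 2) % 8 = 1 →
      HasPrimeToThreeRep N := by
    intro s hs hpos hmod
    obtain ⟨x, y, z, h⟩ := exists_ternary hpos (by omega)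
    -- `x² + y² + 3z² ≡ 1 (mod 8)` forces `z` to be even.
    have hx := sq_emod_eight x
    have hy := sq_emod_eight y
    have hz := sq_emod_eight z
    exact hasPrimeToThreeRep_of_parity (x := x) (y := y) (z := 2 * s) (t := z) hN
      (by linarith) (by omega) (by omega)
  by_cases h : N % 8 = 5
  · exact main 1 (by norm_num) (by omega) (by omega)
  by_cases hlt : 48 < N
  · exact main 2 (by norm_num) (by omega) (by omega)
  obtain rfl | rfl : N = 17 ∨ N = 41 := by omega
  · exact ⟨1, 1, 1, 2, by norm_num⟩
  · exact ⟨1, 5, 1, 2, by norm_num⟩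

lemma hasPrimeToThreeRep_three_mod_four {N : ℤ} (h8 : 8 ≤ N) (hN : N % 3 = 2)
    (h4 : N % 4 = 3) : HasPrimeToThreeRep N := by
  have main : ∀ s K : ℤ, ¬ 3 ∣ s → N = 4 * K + 3 * s ^ 2 → 0 < K → K % 8 ≠ 5 → K % 4 ≠ 0 →
      HasPrimeToThreeRep N := by
    intro s K hs hK hpos h5 h0
    obtain ⟨x, y, z, h⟩ := exists_ternary hpos (by omega)
    have hx := sq_emod_eight x
    have hy := sq_emod_eight y
    have hz := sq_emod_eight z
    -- By the choice of `K` modulo `8`, the parities of `x`, `y`, `z` are not all equal. If `x` and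
    -- `z` differ, then `4 (x² + 3z²) = (x + 3z)² + 3 (x - z)²` with `x + 3z` odd and `2y` even.
    have half : ∀ {x y : ℤ}, K = x ^ 2 + y ^ 2 + 3 * z ^ 2 → x % 2 ≠ z % 2 →
        HasPrimeToThreeRep N := fun {x y} h hxz =>
      hasPrimeToThreeRep_of_parity (x := x + 3 * z) (y := 2 * y) (z := s) (t := x - z) hN
        (by rw [hK, h]; ring) hs (by omega)
    by_cases hxz : x % 2 = z % 2
    · exact half (x := y) (y := x) (by linarith) (by omega)
    · exact half h hxz
  obtain ⟨K, hK⟩ : ∃ K, N = 4 * K + 3 := ⟨N / 4, by omega⟩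
  by_cases hgood : K % 8 ≠ 5 ∧ K % 4 ≠ 0
  · exact main 1 K (by norm_num) (by omega) (by omega) hgood.1 hgood.2
  -- As `3 * 5 ^ 2 = 3 + 4 * 18`, passing from `s = 1` to `s = 5` replaces `K` by `K - 18`.
  by_cases hlt : 75 < N
  · exact main 5 (K - 18) (by norm_num) (by omega) (by omega) (by omega) (by omega)
  obtain rfl | rfl | rfl : N = 23 ∨ N = 35 ∨ N = 71 := by omega
  · exact ⟨1, 4, 1, 1, by norm_num⟩
  · exact ⟨2, 4, 1, 2, by norm_num⟩
  · exact ⟨1, 8, 1, 1, by norm_num⟩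

lemma hasPrimeToThreeRep_two_mod_four {N : ℤ} (h8 : 8 ≤ N) (hN : N % 3 = 2)
    (h4 : N % 4 = 2) : HasPrimeToThreeRep N := by
  obtain ⟨K, rfl⟩ : ∃ K, N = 2 * K := ⟨N / 2, by omega⟩
  by_cases hK : K % 4 = 1
  · -- `x² + y² + 3z² ≡ 2 (mod 4)` forces `z` to be even.
    obtain ⟨x, y, z, h⟩ := exists_ternary (M := K - 3) (by omega) (by omega)
    have hx := sq_emod_eight x
    have hy := sq_emod_eight y
    have hz := sq_emod_eight z
    exact hasPrimeToThreeRep_two_mul (a := x) (b := y) (c := z) (d := 1) (by omega)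
      (by linarith) (by norm_num) (by omega)
  · obtain ⟨L, rfl⟩ : ∃ L, K = 4 * L + 3 := ⟨K / 4, by omega⟩
    obtain ⟨x, y, z, h⟩ := exists_ternary (M := L) (by omega) (by omega)
    exact hasPrimeToThreeRep_two_mul (a := 2 * x) (b := 2 * y) (c := 2 * z) (d := 1) (by omega)
      (by rw [h]; ring) (by norm_num) (by omega)

lemma hasPrimeToThreeRep (N : ℕ) (h8 : 8 ≤ N) (hN : N % 3 = 2) : HasPrimeToThreeRep N := by
  induction N using Nat.strong_induction_on with
  | _ N ih =>
  have : N % 4 = 0 ∨ N % 4 = 1 ∨ N % 4 = 2 ∨ N % 4 = 3 := by omega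
  rcases this with h | h | h | h
  · obtain ⟨K, rfl⟩ : ∃ K, N = 4 * K := ⟨N / 4, by omega⟩
    by_cases hK : 8 ≤ K
    · obtain ⟨x, y, z, t, e, hz, ht⟩ := ih K (by omega) hK (by omega)
      exact ⟨2 * x, 2 * y, 2 * z, 2 * t, by push_cast; rw [← e]; ring, by omega, by omega⟩
    · obtain rfl | rfl : K = 2 ∨ K = 5 := by omega
      · exact ⟨1, 1, 1, 1, by norm_num⟩
      · exact ⟨1, 2, 1, 2, by norm_num⟩
  · exact hasPrimeToThreeRep_one_mod_four (by omega) (by omega) (by omega)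
  · exact hasPrimeToThreeRep_two_mod_four (by omega) (by omega) (by omega)
  · exact hasPrimeToThreeRep_three_mod_four (by omega) (by omega) (by omega)

lemma exists_octagonal {x : ℤ} (hx : ¬ 3 ∣ x) : ∃ u : ℤ, 3 * octagonal u + 1 = x ^ 2 := by
  have : x % 3 = 1 ∨ x % 3 = 2 := by omega
  rcases this with h | h
  · obtain ⟨k, rfl⟩ : ∃ k, x = 3 * k + 1 := ⟨x / 3, by omega⟩
    exact ⟨-k, by unfold octagonal; ring⟩
  · obtain ⟨k, rfl⟩ : ∃ k, x = 3 * k - 1 := ⟨(x + 1) / 3, by omega⟩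
    exact ⟨k, by unfold octagonal; ring⟩

theorem theorem2p1 :
    IsUniversalOctagonalSum 1 1 3 3 ∧
      ∀ n : ℕ, ∃ x y z t : ℤ,
        x ^ 2 + y ^ 2 + 3 * z ^ 2 + 3 * t ^ 2 = 3 * (n : ℤ) + 8 ∧
          ¬ (x * y * z * t ≡ 0 [ZMOD 3]) := by
  have key : ∀ n : ℕ, ∃ x y z t : ℤ,
      x ^ 2 + y ^ 2 + 3 * z ^ 2 + 3 * t ^ 2 = 3 * (n : ℤ) + 8 ∧
        ¬ 3 ∣ x ∧ ¬ 3 ∣ y ∧ ¬ 3 ∣ z ∧ ¬ 3 ∣ t := by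
    intro n
    obtain ⟨x, y, z, t, h, hz, ht⟩ := hasPrimeToThreeRep (3 * n + 8) (by omega) (by omega)
    have hx := sq_emod_three x
    have hy := sq_emod_three y
    push_cast at h
    exact ⟨x, y, z, t, h, by omega, by omega, hz, ht⟩
  refine ⟨fun n => ?_, fun n => ?_⟩
  · obtain ⟨x, y, z, t, h, hx, hy, hz, ht⟩ := key n
    obtain ⟨x', hx'⟩ := exists_octagonal hx
    obtain ⟨y', hy'⟩ := exists_octagonal hy
    obtain ⟨z', hz'⟩ := exists_octagonal hz
    obtain ⟨t', ht'⟩ := exists_octagonal ht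
    refine ⟨x', y', z', t', ?_⟩
    unfold octagonalSum
    linarith
  · obtain ⟨x, y, z, t, h, hx, hy, hz, ht⟩ := key n
    refine ⟨x, y, z, t, h, fun hmod => ?_⟩
    have := Int.modEq_zero_iff_dvd.1 hmod
    rcases Int.prime_three.dvd_or_dvd this with h1 | h1
    · rcases Int.prime_three.dvd_or_dvd h1 with h2 | h2
      · rcases Int.prime_three.dvd_or_dvd h2 with h3 | h3
        · exact hx h3
        · exact hy h3
      · exact hz h2
    · exact ht h1
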